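/- Let $q>2$ be a prime power, $m\ge 2$ an integer, $N=q^m-1$ and $n=(q^m-1)/(q-1)$. Let $\beta$ be a primitive element of $\mathrm{GF}(q^m)$ and put $\lambda=\beta^n$, a primitive element of $\mathrm{GF}(q)$. For a polynomial $g\in \mathrm{GF}(q)[x]$ dividing $x^n-\lambda$, the $\lambda$-constacyclic code of length $n$ with generator polynomial $g$ is the set of all $(c_0,\dots,c_{n-1})\in \mathrm{GF}(q)^n$ such that the class of $c_0+c_1x+\cdots+c_{n-1}x^{n-1}$ lies in the ideal generated by $g$ in $\mathrm{GF}(q)[x]/(x^n-\lambda)$; its defining set (with respect to $\beta$) is the set of those $i\in\{0,\dots,N-1\}$ with $i\equiv 1 \pmod{q-1}$ and $g(\beta^i)=0$. For a linear code $\mathcal C$, let $d(\mathcal C)$ be its minimum Hamming distance. For $0\le i<N$ let $\mathrm{wt}_q(i)$ be the sum of the digits of $i$ in base $q$, let $C_i=\{iq^j \bmod N : j\ge 0\}$ be the $q$-cyclotomic coset of $i$ modulo $N$, and call $i$ a coset leader if it is the smallest element of $C_i$. For $0\le \ell\le m-2$, let $\mathrm{CPRM}(q,m,m-2-\ell)$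 be the $\lambda$-constacyclic code of length $n$ whose defining set is the union of the cosets $C_i$ over all coset leaders $i$ with $i\equiv 1\pmod{q-1}$ and $\mathrm{wt}_q(i)<1+(q-1)(\ell+1)$. For $0\le \ell\le m-1$, let $\mathcal C_{(q,m,\ell)}$ be the $\lambda$-constacyclic code of length $n$ with generator polynomial $$g_{(q,m,\ell)}(x)=\prod_{0\le i<N,\ \mathrm{wt}_q(i)=1+(q-1)\ell}(x-\beta^i)\in \mathrm{GF}(q)[x].$$ Theorem. Let $1\le \ell\le m-2$. Then $$\mathrm{CPRM}(q,m,m-2-\ell)=\mathrm{CPRM}(q,m,m-1-\ell)\cap \mathcal C_{(q,m,\ell)}$$ and $d(\mathcal C_{(q,m,\ell)})\le 3\cdot q^{\ell}$. -/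

import Mathlib

open Polynomial

noncomputable section

namespace Constacyclic

/-! ### Linear codes and constacyclic codes -/

/-- The minimum Hamming distance of a linear code, i.e. the least Hamming distance between two
distinct codewords (`⊤` if the code has no two distinct codewords). -/
def minDist {F : Type*} [Field F] [DecidableEq F] {n : ℕ} (C : Submodule F (Fin n → F)) : ℕ∞ :=
  ⨅ (a ∈ C) (b ∈ C) (_ : a ≠ b), (hammingDist a b : ℕ∞)

/-- The map `φ : F^n → F[x]/(x^n - a)`, `(c₀, …, c_{n-1}) ↦ c₀ + c₁ x + ⋯ + c_{n-1} x^{n-1}`. -/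
def toQuotient {F : Type*} [Field F] (n : ℕ) (a : F) :
    (Fin n → F) →ₗ[F] (F[X] ⧸ Ideal.span {(X ^ n - C a : F[X])}) :=
  (Ideal.Quotient.mkₐ F (Ideal.span {(X ^ n - C a : F[X])})).toLinearMap ∘ₗ
    ∑ i : Fin n, (monomial (i : ℕ)).comp (LinearMap.proj i)

/-- The `a`-constacyclic code of length `n` over `F` generated by `g`: all `c ∈ F^n` such that
`φ(c)` lies in the ideal `(g)` of `F[x]/(x^n - a)`. -/
def constacyclicCode {F : Type*} [Field F] (n : ℕ) (a : F) (g : F[X]) :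
    Submodule F (Fin n → F) :=
  Submodule.comap (toQuotient n a)
    ((Ideal.span {Ideal.Quotient.mk (Ideal.span {(X ^ n - C a : F[X])}) g}).restrictScalars F)

/-! ### Cyclotomic cosets and `q`-weights -/

/-- The sum of the digits of `i` in its `q`-adic expansion. -/
def wtq (q i : ℕ) : ℕ := (Nat.digits q i).sum

/-- The `q`-cyclotomic coset of `i` modulo `N`. -/
def coset (q N i : ℕ) : Finset ℕ :=
  open scoped Classical in (Finset.range N).filter fun k => ∃ j : ℕ, k = i * q ^ j % N

/-- The coset leaders modulo `N`: those `i ∈ {0, …, N - 1}` that are smallest in their coset. -/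
def leaders (q N : ℕ) : Finset ℕ :=
  open scoped Classical in (Finset.range N).filter fun i => ∀ k ∈ coset q N i, i ≤ k

/-- The union of the `q`-cyclotomic cosets `C_i` modulo `q^m - 1` of the coset leaders
`i ≡ 1 (mod q - 1)` with `wt_q(i) < 1 + (q - 1)(ℓ + 1)`. -/
def setD (q m l : ℕ) : Finset ℕ :=
  ((leaders q (q ^ m - 1)).filter fun i =>
    i ≡ 1 [MOD q - 1] ∧ wtq q i < 1 + (q - 1) * (l + 1)).biUnion (coset q (q ^ m - 1))

/-- The set of all `i ∈ {0, …, q^m - 2}` with `wt_q(i) = 1 + (q - 1) ℓ`. -/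
def setT (q m l : ℕ) : Finset ℕ :=
  (Finset.range (q ^ m - 1)).filter fun i => wtq q i = 1 + (q - 1) * l

/-! ### Codes with prescribed zeros -/

/-- The polynomial `∏_{i ∈ Z} (x - β^i)`, with coefficients in the extension field. -/
def zerosPoly {K : Type*} [Field K] (β : K) (Z : Finset ℕ) : K[X] :=
  ∏ i ∈ Z, (X - C (β ^ i))

/-- `∏_{i ∈ Z} (x - β^i)` as a polynomial over the base field `F`. It exists as soon as `Z` is
closed under multiplication by `q = |F|` modulo `|K| - 1`, see `map_genPoly` below. -/
def genPoly (F : Type*) {K : Type*} [Field F] [Field K] [Algebra F K] (β : K) (Z : Finset ℕ) :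
    F[X] :=
  Function.invFun (Polynomial.map (algebraMap F K)) (zerosPoly β Z)

/-- The constacyclic projective Reed–Muller code `CPRM(q, m, h)`, `0 ≤ h ≤ m - 2`: writing
`h = m - 2 - ℓ`, it is the `a`-constacyclic code of length `(q^m - 1)/(q - 1)` whose defining set
with respect to `β` is `setD q m ℓ`. -/
def CPRM {F K : Type*} [Field F] [Field K] [Algebra F K] (q m h : ℕ) (a : F) (β : K) :
    Submodule F (Fin ((q ^ m - 1) / (q - 1)) → F) :=
  constacyclicCode ((q ^ m - 1) / (q - 1)) a (genPoly F β (setD q m (m - 2 - h)))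

/-- The code `C_(q, m, ℓ)`: the `a`-constacyclic code of length `(q^m - 1)/(q - 1)` with generator
polynomial `∏_{i ∈ setT q m ℓ} (x - β^i)`. -/
def codeC {F K : Type*} [Field F] [Field K] [Algebra F K] (q m l : ℕ) (a : F) (β : K) :
    Submodule F (Fin ((q ^ m - 1) / (q - 1)) → F) :=
  constacyclicCode ((q ^ m - 1) / (q - 1)) a (genPoly F β (setT q m l))

/-! ### The generator polynomials have coefficients in the base field -/

theorem wtq_step {q : ℕ} (hq : 1 < q) (x : ℕ) : wtq q x = x % q + wtq q (x / q) := by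
  rcases Nat.eq_zero_or_pos x with rfl | hx
  · simp [wtq]
  · simp [wtq, Nat.digits_def' hq hx]

theorem wtq_add_mul_pow {q : ℕ} (hq : 1 < q) (k : ℕ) :
    ∀ a b : ℕ, b < q ^ k → wtq q (b + q ^ k * a) = wtq q b + wtq q a := by
  induction k with
  | zero => intro a b hb; have : b = 0 := by simpa using hb
            subst this; simp [wtq]
  | succ k ih =>
    intro a b hb
    have h0 : 0 < q := by omega
    have e : b + q ^ (k + 1) * a = b + q * (q ^ k * a) := by ring
    rw [wtq_step hq (b + q ^ (k + 1) * a), wtq_step hq b, e, Nat.add_mul_mod_self_left,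
      Nat.add_mul_div_left _ _ h0, ih a (b / q), add_assoc]
    rw [Nat.div_lt_iff_lt_mul h0]
    rwa [pow_succ] at hb

/-- The `q`-weight is constant on cyclotomic cosets modulo `q^m - 1`. -/
theorem wtq_mul_mod {q : ℕ} (hq : 1 < q) {m i : ℕ} (hi : i < q ^ m - 1) :
    wtq q (i * q % (q ^ m - 1)) = wtq q i := by
  rcases m with _ | k
  · simp at hi
  have hk : 0 < q ^ k := by positivity
  obtain ⟨a, b, hb, rfl⟩ : ∃ a b, b < q ^ k ∧ i = b + q ^ k * a :=
    ⟨i / q ^ k, i % q ^ k, Nat.mod_lt _ hk, (Nat.mod_add_div _ _).symm⟩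
  have ha : a < q := by
    by_contra! h
    have : q ^ k * q ≤ q ^ k * a := Nat.mul_le_mul_left _ h
    rw [pow_succ] at hi
    omega
  have hN : q ^ (k + 1) - 1 + 1 = q ^ (k + 1) :=
    Nat.sub_add_cancel (Nat.one_le_pow _ _ (by omega))
  have e : (b + q ^ k * a) * q = (a + q * b) + (q ^ (k + 1) - 1) * a := by
    have : (b + q ^ k * a) * q = q * b + q ^ (k + 1) * a := by ring
    rw [this]
    nth_rewrite 1 [← hN]
    ring
  have hlt : a + q * b < q ^ (k + 1) - 1 := by
    have h1 : q * b + q ≤ q ^ (k + 1) := by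
      have : q * (b + 1) ≤ q * q ^ k := Nat.mul_le_mul_left _ hb
      rw [pow_succ]; linarith
    by_contra! hcon
    have ha' : a + 1 = q := by omega
    have hb' : q * (b + 1) = q * q ^ k := by
      have : q * q ^ k = q ^ (k + 1) := by ring
      rw [this, mul_add]; omega
    have hb'' : b + 1 = q ^ k := Nat.eq_of_mul_eq_mul_left (by omega) hb'
    have : q ^ (k + 1) = q ^ k * (a + 1) := by rw [pow_succ, ha']
    rw [this, mul_add] at hi
    omega
  rw [e, Nat.add_mul_mod_self_left, Nat.mod_eq_of_lt hlt, wtq_add_mul_pow hq k _ _ hb,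
    wtq_step hq, Nat.add_mul_mod_self_left, Nat.add_mul_div_left _ _ (by omega),
    Nat.mod_eq_of_lt ha, Nat.div_eq_of_lt ha, zero_add, add_comm]
  congr 1
  rw [wtq_step hq a, Nat.mod_eq_of_lt ha, Nat.div_eq_of_lt ha]
  simp [wtq]

theorem setT_closed {q : ℕ} (hq : 1 < q) (m l : ℕ) :
    setT q m l ⊆ Finset.range (q ^ m - 1) ∧
      ∀ i ∈ setT q m l, i * q % (q ^ m - 1) ∈ setT q m l := by
  refine ⟨Finset.filter_subset _ _, fun i hi => ?_⟩
  simp only [setT, Finset.mem_filter, Finset.mem_range] at hi ⊢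
  exact ⟨Nat.mod_lt _ (by omega), by rw [wtq_mul_mod hq hi.1, hi.2]⟩

theorem setD_closed (q m l : ℕ) :
    setD q m l ⊆ Finset.range (q ^ m - 1) ∧
      ∀ i ∈ setD q m l, i * q % (q ^ m - 1) ∈ setD q m l := by
  constructor
  · intro i hi
    simp only [setD, Finset.mem_biUnion] at hi
    obtain ⟨_, _, h⟩ := hi
    simp only [coset, Finset.mem_filter] at h
    exact h.1
  · intro i hi
    simp only [setD, Finset.mem_biUnion] at hi ⊢
    obtain ⟨k, hk, h⟩ := hi
    refine ⟨k, hk, ?_⟩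
    simp only [coset, Finset.mem_filter, Finset.mem_range] at h ⊢
    obtain ⟨h1, j, rfl⟩ := h
    exact ⟨Nat.mod_lt _ (by omega), j + 1, by rw [Nat.mod_mul_mod, pow_succ, mul_assoc]⟩

/-- An element `x` of an extension of the finite field `F` with `x ^ |F| = x` lies in `F`. -/
theorem mem_range_of_pow_card {F K : Type*} [Field F] [Fintype F] [Field K] [Algebra F K]
    {x : K} (hx : x ^ Fintype.card F = x) : x ∈ (algebraMap F K).range := by
  have h := FiniteField.X_pow_card_sub_X_ne_zero F Fintype.one_lt_card (p := Fintype.card F)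
  have hs : (X ^ Fintype.card F - X : F[X]).Splits := by
    rw [splits_iff_card_roots, FiniteField.roots_X_pow_card_sub_X,
      FiniteField.X_pow_card_sub_X_natDegree_eq _ Fintype.one_lt_card]
    rfl
  exact hs.mem_range_of_isRoot h (by simp [hx])

/-- If `Z` is closed under multiplication by `q`, then `genPoly F β Z` is `∏_{i ∈ Z} (x - β^i)`. -/
theorem map_genPoly {F K : Type*} [Field F] [Field K] [Algebra F K] {q m : ℕ} (hq : 1 < q)
    (hF : Nat.card F = q) {β : K} (hβ : IsPrimitiveRoot β (q ^ m - 1)) {Z : Finset ℕ}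
    (hZ : Z ⊆ Finset.range (q ^ m - 1)) (hc : ∀ i ∈ Z, i * q % (q ^ m - 1) ∈ Z) :
    (genPoly F β Z).map (algebraMap F K) = zerosPoly β Z := by
  have : Finite F := Nat.finite_of_card_ne_zero (by omega)
  have := Fintype.ofFinite F
  have hF' : Fintype.card F = q := by rw [← hF, Nat.card_eq_fintype_card]
  have hpow : ∀ i, β ^ (i * q % (q ^ m - 1)) = (β ^ i) ^ q := fun i => by
    rw [← pow_mul, hβ.eq_orderOf, pow_mod_orderOf]
  have hinj : Set.InjOn (fun i => i * q % (q ^ m - 1)) Z := by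
    intro i hi j hj hij
    have h1 : (β ^ i) ^ q = (β ^ j) ^ q := by
      rw [← hpow, ← hpow]; exact congrArg (β ^ ·) hij
    have h2 : β ^ i = β ^ j := by
      rw [← hF'] at h1
      exact (FiniteField.frobeniusAlgHom F K).toRingHom.injective h1
    exact hβ.pow_inj (Finset.mem_range.1 (hZ hi)) (Finset.mem_range.1 (hZ hj)) h2
  have himg : Z.image (fun i => i * q % (q ^ m - 1)) = Z :=
    Finset.eq_of_subset_of_card_le (Finset.image_subset_iff.2 hc)
      (Finset.card_image_of_injOn hinj).ge
  have hfix : (zerosPoly β Z).map (FiniteField.frobeniusAlgHom F K).toRingHom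
      = zerosPoly β Z := by
    conv_rhs => rw [zerosPoly, ← himg, Finset.prod_image hinj]
    rw [zerosPoly, Polynomial.map_prod]
    refine Finset.prod_congr rfl fun i _ => ?_
    rw [Polynomial.map_sub, map_X, map_C, hpow, ← hF']
    rfl
  have hex : ∃ g : F[X], g.map (algebraMap F K) = zerosPoly β Z := by
    rw [← Polynomial.mem_lifts, Polynomial.lifts_iff_coeff_lifts]
    intro k
    refine mem_range_of_pow_card ?_
    conv_rhs => rw [← hfix]
    rw [coeff_map]
    rfl
  exact Function.invFun_eq hex

end Constacyclic

end

noncomputable section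

namespace Constacyclic

/-! ### Cyclotomic cosets -/

/-! Membership in each code means vanishing of the power sums `∑ c_j (β^j)^i` for `i` in the
defining set. Since `i ≡ wt_q(i) (mod q - 1)`, weights of exponents `i ≡ 1` jump in steps of `q -
1`, so raising the bound by one step adds exactly `setT` (`setD_succ`); the intersection formula
follows.

For the distance, take an `ℓ`-dimensional `F`-subspace `V` of `K` and `u`, `v` independent modulo
`V`. By Frobenius, `x^i` is a product of `1 + (q - 1)ℓ` linear maps. Expand `∑_{t ∈ V} (u + t)^i`:
terms with two or more factors in `u` vanish by a Chevalley–Warning count, the term with none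
vanishes by scaling, and what remains is additive in `u` (`sum_add_pow_additive`). Hence weights `1,
1, -1` on `u + V`, `v + V`, `u + v + V` give a codeword on at most `3 q^ℓ` projective points. -/

theorem wtq_modEq {q : ℕ} (hq : 2 < q) (i : ℕ) : i ≡ wtq q i [MOD q - 1] := by
  refine Nat.modEq_digits_sum (q - 1) q ?_ i
  obtain ⟨k, rfl⟩ : ∃ k, q = k + 1 := ⟨q - 1, by omega⟩
  simpa using Nat.mod_eq_of_lt (by omega : 1 < k)

theorem mem_coset {q N i k : ℕ} : k ∈ coset q N i ↔ k < N ∧ ∃ j, k = i * q ^ j % N := by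
  simp [coset]

theorem wtq_mul_pow_mod {q : ℕ} (hq : 1 < q) {m i : ℕ} (hi : i < q ^ m - 1) (j : ℕ) :
    wtq q (i * q ^ j % (q ^ m - 1)) = wtq q i := by
  induction j with
  | zero => simp [Nat.mod_eq_of_lt hi]
  | succ j ih =>
    rw [pow_succ, ← mul_assoc, ← Nat.mod_mul_mod, wtq_mul_mod hq (Nat.mod_lt _ (by omega)), ih]

theorem self_mem_coset {q N i : ℕ} (hi : i < N) : i ∈ coset q N i :=
  mem_coset.2 ⟨hi, 0, by simp [Nat.mod_eq_of_lt hi]⟩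

theorem exists_leader {q m i : ℕ} (hq : 1 < q) (hi : i < q ^ m - 1) :
    ∃ k ∈ leaders q (q ^ m - 1), i ∈ coset q (q ^ m - 1) k := by
  obtain ⟨k, hk, hmin⟩ := (coset q (q ^ m - 1) i).exists_min_image id ⟨i, self_mem_coset hi⟩
  obtain ⟨hkN, j, hj⟩ := mem_coset.1 hk
  have hN : ∀ r, q ^ (m * r) ≡ 1 [MOD q ^ m - 1] := fun r => by
    have h1 : q ^ m ≡ 1 [MOD q ^ m - 1] :=
      ((Nat.modEq_iff_dvd' (Nat.one_le_pow _ _ (by omega))).2 dvd_rfl).symm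
    simpa [pow_mul] using h1.pow r
  -- As `q^m ≡ 1`, multiplication by `q^j` is undone by `q^(m*j - j)`.
  refine ⟨k, ?_, mem_coset.2 ⟨hi, m * j - j, ?_⟩⟩
  · simp only [leaders, Finset.mem_filter, Finset.mem_range]
    refine ⟨hkN, fun x hx => hmin x ?_⟩
    obtain ⟨hxN, r, rfl⟩ := mem_coset.1 hx
    exact mem_coset.2 ⟨hxN, j + r, by rw [hj, Nat.mod_mul_mod, pow_add, mul_assoc]⟩
  · have hm : 1 ≤ m := by
      rcases m with _ | m
      · simp at hi
      · omega
    have hle : j ≤ m * j := Nat.le_mul_of_pos_left j hm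
    rw [hj, Nat.mod_mul_mod, mul_assoc, ← pow_add, Nat.add_sub_cancel' hle]
    conv_lhs => rw [← Nat.mod_eq_of_lt hi, ← mul_one i]
    exact ((hN j).mul_left i).symm

/-- Weight, hence also residue modulo `q - 1`, is constant on cosets, so leaders can be forgotten.
-/
theorem mem_setD {q m l i : ℕ} (hq : 2 < q) :
    i ∈ setD q m l ↔
      i < q ^ m - 1 ∧ i ≡ 1 [MOD q - 1] ∧ wtq q i < 1 + (q - 1) * (l + 1) := by
  have hmod : ∀ i k, wtq q i = wtq q k → (i ≡ 1 [MOD q - 1] ↔ k ≡ 1 [MOD q - 1]) := fun i k h =>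
    have hik : i ≡ k [MOD q - 1] := (wtq_modEq hq i).trans (h ▸ (wtq_modEq hq k).symm)
    ⟨hik.symm.trans, hik.trans⟩
  simp only [setD, Finset.mem_biUnion, Finset.mem_filter]
  constructor
  · rintro ⟨k, ⟨hk, hk1, hkw⟩, hi⟩
    simp only [leaders, Finset.mem_filter, Finset.mem_range] at hk
    obtain ⟨hiN, j, rfl⟩ := mem_coset.1 hi
    have hw := wtq_mul_pow_mod (by omega : 1 < q) hk.1 j
    exact ⟨hiN, (hmod _ _ hw).2 hk1, hw ▸ hkw⟩
  · rintro ⟨hiN, hi1, hiw⟩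
    obtain ⟨k, hk, hi⟩ := exists_leader (by omega : 1 < q) hiN
    have hkN : k < q ^ m - 1 := by
      simp only [leaders, Finset.mem_filter, Finset.mem_range] at hk
      exact hk.1
    obtain ⟨-, j, hj⟩ := mem_coset.1 hi
    have hw := wtq_mul_pow_mod (by omega : 1 < q) hkN j
    rw [← hj] at hw
    exact ⟨k, ⟨hk, (hmod _ _ hw).1 hi1, hw ▸ hiw⟩, hi⟩

theorem mem_setT {q m l i : ℕ} : i ∈ setT q m l ↔ i < q ^ m - 1 ∧ wtq q i = 1 + (q - 1) * l := by
  simp [setT]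

theorem modEq_one_of_mem_setT {q m l i : ℕ} (hq : 2 < q) (hi : i ∈ setT q m l) :
    i ≡ 1 [MOD q - 1] := by
  have h := wtq_modEq hq i
  rw [(mem_setT.1 hi).2] at h
  exact h.trans (by simp [Nat.ModEq])

theorem setD_succ {q : ℕ} (hq : 2 < q) (m l : ℕ) :
    setD q m (l + 1) = setD q m l ∪ setT q m (l + 1) := by
  ext i
  rw [Finset.mem_union, mem_setD hq, mem_setD hq]
  constructor
  · rintro ⟨h1, h2, h3⟩
    by_cases h : wtq q i < 1 + (q - 1) * (l + 1)
    · exact Or.inl ⟨h1, h2, h⟩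
    · refine Or.inr (mem_setT.2 ⟨h1, ?_⟩)
      have h4 : 1 + (q - 1) * (l + 1) ≡ wtq q i [MOD q - 1] :=
        Nat.ModEq.trans (by simp [Nat.ModEq]) (h2.symm.trans (wtq_modEq hq i))
      have h5 := (Nat.modEq_iff_dvd' (not_lt.1 h)).1 h4
      have h6 : wtq q i - (1 + (q - 1) * (l + 1)) < q - 1 := by
        have : (q - 1) * (l + 1 + 1) = (q - 1) * (l + 1) + (q - 1) := by ring
        omega
      have := Nat.eq_zero_of_dvd_of_lt h5 h6
      omega
  · have hle : (q - 1) * (l + 1) < (q - 1) * (l + 1 + 1) :=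
      Nat.mul_lt_mul_of_pos_left (Nat.lt_succ_self _) (by omega)
    rintro (⟨h1, h2, h3⟩ | h)
    · exact ⟨h1, h2, by omega⟩
    · exact ⟨(mem_setT.1 h).1, modEq_one_of_mem_setT hq h, by rw [(mem_setT.1 h).2]; omega⟩

/-! ### Membership in a constacyclic code through zeros -/

theorem prod_X_sub_C_dvd {K : Type*} [Field K] {Z : Finset ℕ} {f : ℕ → K} (hf : Set.InjOn f Z)
    {P : K[X]} (h : ∀ i ∈ Z, P.eval (f i) = 0) : ∏ i ∈ Z, (X - C (f i)) ∣ P := by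
  refine Finset.prod_dvd_of_coprime (fun i hi j hj hij => ?_) fun i hi =>
    dvd_iff_isRoot.2 (h i hi)
  exact isCoprime_X_sub_C_of_isUnit_sub (sub_ne_zero.2 fun h => hij (hf hi hj h)).isUnit

/-- For `i ≡ 1 (mod q - 1)`, `(β^i)^n = a^i = a`, so evaluation at `β^i` is well defined modulo `X^n
- a`. Conversely the roots `β^i` are distinct, and divisibility over `K` descends to `F`. -/
theorem mem_constacyclicCode_genPoly {F K : Type*} [Field F] [Field K] [Algebra F K] {q m n : ℕ}
    (hq : 1 < q) (hF : Nat.card F = q) {β : K} (hβ : IsPrimitiveRoot β (q ^ m - 1))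
    {a : F} (ha : algebraMap F K a = β ^ n) {Z : Finset ℕ}
    (hZ : Z ⊆ Finset.range (q ^ m - 1) ∧ ∀ i ∈ Z, i * q % (q ^ m - 1) ∈ Z)
    (hZ1 : ∀ i ∈ Z, i ≡ 1 [MOD q - 1]) (c : Fin n → F) :
    c ∈ constacyclicCode n a (genPoly F β Z) ↔
      ∀ i ∈ Z, ∑ j : Fin n, algebraMap F K (c j) * (β ^ (j : ℕ)) ^ i = 0 := by
  have hmap := map_genPoly hq hF hβ hZ.1 hZ.2
  have : Finite F := Nat.finite_of_card_ne_zero (by omega)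
  have := Fintype.ofFinite F
  have haZ : ∀ i ∈ Z, a ^ i = a := by
    intro i hi
    have ha0 : a ≠ 0 := by
      rintro rfl
      have hβ0 : β ≠ 0 := hβ.ne_zero (by have := Finset.mem_range.1 (hZ.1 hi); omega)
      exact pow_ne_zero n hβ0 (by rw [← ha, map_zero])
    have h1 : a ^ (q - 1) = 1 := by
      rw [← hF, Nat.card_eq_fintype_card]; exact FiniteField.pow_card_sub_one_eq_one a ha0
    simpa using pow_eq_pow_of_modEq (hZ1 i hi) h1
  have hroot : ∀ i ∈ Z, (zerosPoly β Z).eval (β ^ i) = 0 := fun i hi => by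
    rw [zerosPoly, eval_prod]
    exact Finset.prod_eq_zero hi (by simp)
  have hX : ∀ i ∈ Z, ((X ^ n - C a : F[X]).map (algebraMap F K)).eval (β ^ i) = 0 := fun i hi => by
    simp only [Polynomial.map_sub, Polynomial.map_pow, map_X, map_C, eval_sub, eval_pow, eval_X,
      eval_C]
    rw [← pow_mul, mul_comm, pow_mul, ← ha, ← map_pow, haZ i hi, sub_self]
  set P : F[X] := ∑ j : Fin n, monomial (j : ℕ) (c j) with hP
  have hPe : ∀ i, (P.map (algebraMap F K)).eval (β ^ i) =
      ∑ j : Fin n, algebraMap F K (c j) * (β ^ (j : ℕ)) ^ i := fun i => by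
    simp only [hP, Polynomial.map_sum, map_monomial, eval_finsetSum, eval_monomial]
    refine Finset.sum_congr rfl fun j _ => ?_
    rw [← pow_mul, ← pow_mul, mul_comm i]
  have htq : toQuotient n a c = Ideal.Quotient.mk _ P := by
    simp [toQuotient, hP]
  simp only [← hPe]
  rw [constacyclicCode, Submodule.mem_comap, Submodule.restrictScalars_mem, htq,
    Ideal.mem_span_singleton]
  constructor
  · rintro ⟨r, hr⟩ i hi
    obtain ⟨r, rfl⟩ := Ideal.Quotient.mk_surjective r
    rw [← map_mul, Ideal.Quotient.eq, Ideal.mem_span_singleton] at hr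
    obtain ⟨s, hs⟩ := hr
    have hPs : P = genPoly F β Z * r + (X ^ n - C a) * s := by rw [← hs]; ring
    rw [hPs, Polynomial.map_add, Polynomial.map_mul, Polynomial.map_mul, hmap, eval_add, eval_mul,
      eval_mul, hroot i hi, hX i hi, zero_mul, zero_mul, add_zero]
  · intro h
    refine map_dvd _ ((Polynomial.map_dvd_map' (algebraMap F K)).1 ?_)
    rw [hmap]
    refine prod_X_sub_C_dvd (fun i hi j hj hij => ?_) h
    exact hβ.pow_inj (Finset.mem_range.1 (hZ.1 hi)) (Finset.mem_range.1 (hZ.1 hj)) hij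

/-! ### Power sums over affine subspaces -/

/-- `x ^ i` is a product of `wt_q(i)` linear maps. -/
theorem exists_linearMap_prod_eq_pow {F K : Type*} [Field F] [Fintype F] [Field K] [Algebra F K]
    (i : ℕ) : ∃ φ : Fin (wtq (Fintype.card F) i) → (K →ₗ[F] K), ∀ x, x ^ i = ∏ k, φ k x := by
  suffices h : ∃ L : List (K →ₗ[F] K), L.length = wtq (Fintype.card F) i ∧
      ∀ x, x ^ i = (L.map fun φ => φ x).prod by
    obtain ⟨L, hL, h⟩ := h
    rw [← hL]
    refine ⟨L.get, fun x => ?_⟩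
    rw [h, ← List.prod_ofFn]
    congr 1
    conv_lhs => rw [← List.ofFn_get L, List.map_ofFn]
    rfl
  have hq : 1 < Fintype.card F := Fintype.one_lt_card
  induction i using Nat.strong_induction_on with
  | _ i ih =>
    rcases Nat.eq_zero_or_pos i with rfl | hi
    · exact ⟨[], by simp [wtq]⟩
    obtain ⟨L, hL, h⟩ := ih (i / Fintype.card F) (Nat.div_lt_self hi hq)
    -- The lowest digit contributes copies of the identity; the higher digits are handled at `x^q`,
    -- which is `F`-linear in `x`.
    refine ⟨List.replicate (i % Fintype.card F) LinearMap.id ++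
      L.map fun φ => φ ∘ₗ (FiniteField.frobeniusAlgHom F K).toLinearMap, ?_, fun x => ?_⟩
    · rw [wtq_step hq i]; simp [hL]
    · have := h (x ^ Fintype.card F)
      conv_lhs => rw [← Nat.mod_add_div i (Fintype.card F), pow_add, pow_mul, this]
      simp [Function.comp_def, FiniteField.coe_frobeniusAlgHom]

/-- In coordinates the product expands into monomials of degree below `(q - 1) dim`, whose sums over
`F^σ` vanish. -/
theorem sum_prod_linearMap_eq_zero {F K σ ι : Type*} [Field F] [Fintype F] [Field K] [Algebra F K]
    [Fintype σ] [DecidableEq σ] [Fintype ι] [DecidableEq ι] (y : ι → (σ → F) →ₗ[F] K)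
    (h : Fintype.card ι < (Fintype.card F - 1) * Fintype.card σ) :
    ∑ t : σ → F, ∏ k, y k t = 0 := by
  have hy : ∀ k t, y k t = ∑ s, t s • y k (Pi.single s 1) := fun k t => by
    conv_lhs => rw [pi_eq_sum_univ' t, map_sum]
    simp [map_smul]
  have hprod : ∀ t, ∏ k, y k t = ∑ p ∈ Fintype.piFinset fun _ => Finset.univ,
      ∏ k, t (p k) • y k (Pi.single (p k) 1) := fun t => by
    rw [Finset.prod_congr rfl fun k _ => hy k t, Finset.prod_univ_sum]
  simp_rw [hprod]
  rw [Finset.sum_comm]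
  refine Finset.sum_eq_zero fun p _ => ?_
  simp_rw [Finset.prod_smul, ← Finset.sum_smul]
  have := MvPolynomial.sum_eval_eq_zero (∏ k, MvPolynomial.X (R := F) (p k)) (by
    refine ((MvPolynomial.totalDegree_finsetProd _ _).trans ?_).trans_lt h
    simp)
  simp only [map_prod, MvPolynomial.eval_X] at this
  rw [this, zero_smul]

/-- Substituting `b • t` for `t`, with `b ≠ 0, 1`, multiplies the sum by `b^i = b`. -/
theorem sum_pow_eq_zero_of_modEq_one {F K σ : Type*} [Field F] [Fintype F] [Field K] [Algebra F K]
    [Fintype σ] (hF : 2 < Fintype.card F) (y : (σ → F) →ₗ[F] K) {i : ℕ}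
    (hi : i ≡ 1 [MOD Fintype.card F - 1]) [Fintype (σ → F)] : ∑ t, y t ^ i = 0 := by
  classical
  obtain ⟨b, hb0, hb1⟩ : ∃ b : F, b ≠ 0 ∧ b ≠ 1 := by
    by_contra! h
    have : (Finset.univ : Finset F) ⊆ {0, 1} := fun x _ => by
      by_cases hx : x = 0
      · simp [hx]
      · simp [h x hx]
    have := (Finset.card_le_card this).trans Finset.card_le_two
    rw [Finset.card_univ] at this
    omega
  have hbi : b ^ i = b := by
    simpa using pow_eq_pow_of_modEq hi (FiniteField.pow_card_sub_one_eq_one b hb0)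
  have h : ∑ t, y t ^ i = b • ∑ t, y t ^ i := by
    rw [Finset.smul_sum, ← Equiv.sum_comp (LinearEquiv.smulOfNeZero F (σ → F) b hb0).toEquiv]
    refine Finset.sum_congr rfl fun t _ => ?_
    change y (b • t) ^ i = _
    rw [map_smul, _root_.smul_pow, hbi]
  have h2 : (1 - b) • ∑ t, y t ^ i = 0 := by rw [sub_smul, one_smul, ← h, sub_self]
  exact (smul_eq_zero.1 h2).resolve_left (sub_ne_zero.2 (Ne.symm hb1))

/-- Summing `x ^ i`, with `wt_q(i) = 1 + (q - 1) ℓ`, over the translates of an `ℓ`-dimensional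
subspace is additive in the translation. -/
theorem sum_add_pow_additive {F K σ : Type*} [Field F] [Fintype F] [Field K] [Algebra F K]
    [Fintype σ] [DecidableEq σ] (hF : 2 < Fintype.card F) (y : (σ → F) →ₗ[F] K) {i : ℕ}
    (hi : wtq (Fintype.card F) i = 1 + (Fintype.card F - 1) * Fintype.card σ) (u v : K) :
    ∑ t, (u + v + y t) ^ i = ∑ t, (u + y t) ^ i + ∑ t, (v + y t) ^ i := by
  have hi1 : i ≡ 1 [MOD Fintype.card F - 1] := by
    have h := wtq_modEq hF i
    rw [hi] at h
    exact h.trans (by simp [Nat.ModEq])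
  have h0 := sum_pow_eq_zero_of_modEq_one hF y hi1
  obtain ⟨φ, hφ⟩ := exists_linearMap_prod_eq_pow (F := F) (K := K) i
  simp only [hφ, map_add _ _ (y _)] at h0 ⊢
  simp only [Fintype.prod_add]
  rw [Finset.sum_comm, Finset.sum_comm (s := Finset.univ (α := σ → F)),
    Finset.sum_comm (s := Finset.univ (α := σ → F)), ← Finset.sum_add_distrib]
  refine Finset.sum_congr rfl fun S _ => ?_
  simp_rw [← Finset.mul_sum]
  -- `S` indexes the factors evaluated at the translation; if `|S| ≥ 2`, fewer than `(q - 1)ℓ`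
  -- factors involve `t`.
  rcases S.eq_empty_or_nonempty with rfl | hS
  · simp [h0]
  by_cases hS1 : S.card = 1
  · obtain ⟨k, rfl⟩ := Finset.card_eq_one.1 hS1
    simp [add_mul]
  · have hz : ∑ t : σ → F, ∏ k ∈ Sᶜ, φ k (y t) = 0 := by
      have := sum_prod_linearMap_eq_zero (fun k : (Sᶜ : Finset _) => φ k ∘ₗ y) (by
        have := hS.card_pos
        have h1 := Finset.card_compl S
        have h2 := S.card_le_univ
        rw [Fintype.card_fin] at h1 h2
        rw [Fintype.card_coe]
        omega)
      rw [← this]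
      exact Finset.sum_congr rfl fun t _ => (Finset.prod_coe_sort Sᶜ fun k => φ k (y t)).symm
    simp [hz]

/-! ### Codewords supported on few projective points -/

/-- The powers `β^j`, `j < (q^m - 1)/(q - 1)`, represent all points of the projective space. -/
theorem exists_eq_smul_pow {F K : Type*} [Field F] [Field K] [Algebra F K] [FiniteDimensional F K]
    {q m : ℕ} (hq : 2 < q) (hm : 0 < m) (hF : Nat.card F = q) (hK : Module.finrank F K = m) {β : K}
    (hβ : IsPrimitiveRoot β (q ^ m - 1)) {a : F}
    (ha : algebraMap F K a = β ^ ((q ^ m - 1) / (q - 1))) (x : K) :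
    ∃ (b : F) (j : Fin ((q ^ m - 1) / (q - 1))), x = b • β ^ (j : ℕ) := by
  have hqm : q ≤ q ^ m := Nat.le_self_pow hm.ne' q
  have hN : 0 < q ^ m - 1 := by omega
  have hn : 0 < (q ^ m - 1) / (q - 1) := Nat.div_pos (by omega) (by omega)
  rcases eq_or_ne x 0 with rfl | hx
  · exact ⟨0, ⟨0, hn⟩, by simp⟩
  have : Finite F := Nat.finite_of_card_ne_zero (by omega)
  have : Finite K := Module.finite_of_finite F
  have := Fintype.ofFinite F
  have := Fintype.ofFinite K
  have hcard : Fintype.card K = q ^ m := by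
    rw [Module.card_eq_pow_finrank (K := F), hK, ← hF, Nat.card_eq_fintype_card]
  have : NeZero (q ^ m - 1) := ⟨hN.ne'⟩
  obtain ⟨k, -, rfl⟩ := hβ.eq_pow_of_pow_eq_one (hcard ▸ FiniteField.pow_card_sub_one_eq_one x hx)
  set n := (q ^ m - 1) / (q - 1)
  refine ⟨a ^ (k / n), ⟨k % n, Nat.mod_lt _ hn⟩, ?_⟩
  rw [Algebra.smul_def, map_pow, ha, ← pow_mul, ← pow_add, Nat.div_add_mod]

/-- Finitely many weighted points of `K` give a word whose power sums at the exponents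
`i ≡ 1 (mod q - 1)` are the weighted power sums of the points. -/
theorem exists_word_of_points {F K ι : Type*} [Field F] [DecidableEq F] [Field K] [Algebra F K]
    [FiniteDimensional F K] [Fintype ι] {q m : ℕ} (hq : 2 < q) (hm : 0 < m)
    (hF : Nat.card F = q) (hK : Module.finrank F K = m) {β : K}
    (hβ : IsPrimitiveRoot β (q ^ m - 1)) {a : F}
    (ha : algebraMap F K a = β ^ ((q ^ m - 1) / (q - 1))) (p : ι → K) (w : ι → F) :
    ∃ c : Fin ((q ^ m - 1) / (q - 1)) → F,
      (∀ i, i ≡ 1 [MOD q - 1] →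
        ∑ j, algebraMap F K (c j) * (β ^ (j : ℕ)) ^ i = ∑ s, algebraMap F K (w s) * p s ^ i) ∧
      hammingNorm c ≤ Fintype.card ι ∧
      ∀ s₀, w s₀ ≠ 0 → p s₀ ≠ 0 → (∀ s (r : F), p s = r • p s₀ → s = s₀) → c ≠ 0 := by
  classical
  have : Finite F := Nat.finite_of_card_ne_zero (by omega)
  have := Fintype.ofFinite F
  choose b idx hb using fun s => exists_eq_smul_pow hq hm hF hK hβ ha (p s)
  -- Since `b^i = b` on `F`, the scalar in `p s = b s • β^(idx s)` can be absorbed into the weight.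
  refine ⟨fun j => ∑ s, if idx s = j then w s * b s else 0, fun i hi => ?_, ?_, ?_⟩
  · have hbi : ∀ x : F, x ^ i = x := fun x => by
      rcases eq_or_ne x 0 with rfl | hx
      · refine zero_pow ?_
        rintro rfl
        have := (Nat.modEq_iff_dvd' (Nat.zero_le 1)).1 hi
        have := Nat.le_of_dvd one_pos this
        omega
      · have h1 : x ^ (q - 1) = 1 := by
          rw [← hF, Nat.card_eq_fintype_card]; exact FiniteField.pow_card_sub_one_eq_one x hx
        simpa using pow_eq_pow_of_modEq hi h1
    simp_rw [map_sum, Finset.sum_mul]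
    rw [Finset.sum_comm]
    refine Finset.sum_congr rfl fun s _ => ?_
    rw [Finset.sum_eq_single (idx s) (fun j _ hj => by simp [hj.symm]) (by simp), hb s,
      Algebra.smul_def, mul_pow, ← map_pow, hbi]
    simp [mul_assoc]
  · refine (Finset.card_le_card (t := Finset.univ.image idx) fun j hj => ?_).trans
      (Finset.card_image_le.trans Finset.card_univ.le)
    simp only [Finset.mem_filter, Finset.mem_univ, true_and] at hj
    obtain ⟨s, -, hs⟩ := Finset.exists_ne_zero_of_sum_ne_zero hj
    exact Finset.mem_image.2 ⟨s, Finset.mem_univ _, by_contra fun h => hs (if_neg h)⟩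
  · intro s₀ hw hp hs hc
    have hb0 : b s₀ ≠ 0 := fun h => hp (by rw [hb s₀, h, zero_smul])
    have h := congrFun hc (idx s₀)
    simp only [Pi.zero_apply] at h
    -- No other point is proportional to `p s₀`, so nothing cancels its contribution at `idx s₀`.
    rw [Finset.sum_eq_single s₀ (fun s _ hne => if_neg fun he => hne (hs s (b s * (b s₀)⁻¹) ?_))
      (by simp), if_pos rfl] at h
    · exact mul_ne_zero hw hb0 h
    · rw [hb s, hb s₀, he, smul_smul, mul_assoc, inv_mul_cancel₀ hb0, mul_one]

theorem minDist_le_hammingNorm {F : Type*} [Field F] [DecidableEq F] {n : ℕ}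
    {D : Submodule F (Fin n → F)} {c : Fin n → F} (hc : c ∈ D) (h0 : c ≠ 0) :
    minDist D ≤ hammingNorm c :=
  (iInf₂_le_of_le c hc (iInf₂_le_of_le 0 D.zero_mem (iInf_le _ h0))).trans_eq
    (by rw [hammingDist_zero_right])

/-- A linear map from `F^l`, and two vectors that are linearly independent modulo its range. -/
theorem exists_linearMap_and_pair {F K : Type*} [Field F] [Field K] [Algebra F K]
    [FiniteDimensional F K] {l : ℕ} (hl : l + 2 ≤ Module.finrank F K) :
    ∃ (y : (Fin l → F) →ₗ[F] K) (u v : K), ∀ (t : Fin l → F) (r s : F),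
      r • u + s • v + y t = 0 → r = 0 ∧ s = 0 ∧ t = 0 := by
  have hli := (Module.finBasis F K).linearIndependent.comp _
    ((Fin.castLE_injective hl).comp (finSumFinEquiv (m := l) (n := 2)).injective)
  set e := Module.finBasis F K ∘ Fin.castLE hl ∘ finSumFinEquiv
  refine ⟨Fintype.linearCombination F (e ∘ Sum.inl), e (Sum.inr 0), e (Sum.inr 1),
    fun t r s h => ?_⟩
  have := Fintype.linearIndependent_iff.1 hli (Sum.elim t ![r, s]) (by
    rw [← h, Fintype.sum_sum_type, Fin.sum_univ_two, Fintype.linearCombination_apply, add_comm]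
    rfl)
  exact ⟨this (Sum.inr 0), this (Sum.inr 1), funext fun i => this (Sum.inl i)⟩

theorem minDist_codeC_le {F K : Type*} [Field F] [DecidableEq F] [Field K] [Algebra F K]
    {q m l : ℕ} (hq : 2 < q) (hF : Nat.card F = q) (hK : Module.finrank F K = m)
    {β : K} (hβ : IsPrimitiveRoot β (q ^ m - 1)) {a : F}
    (ha : algebraMap F K a = β ^ ((q ^ m - 1) / (q - 1))) (hl : l + 2 ≤ m) :
    minDist (codeC q m l a β) ≤ ((3 * q ^ l : ℕ) : ℕ∞) := by
  have : Finite F := Nat.finite_of_card_ne_zero (by omega)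
  have := Fintype.ofFinite F
  have hF' : Fintype.card F = q := by rw [← hF, Nat.card_eq_fintype_card]
  have : FiniteDimensional F K := Module.finite_of_finrank_pos (by omega)
  obtain ⟨y, u, v, hind⟩ := exists_linearMap_and_pair (F := F) (K := K) (hl.trans_eq hK.symm)
  let A : Fin 3 → F := ![1, 0, 1]
  let B : Fin 3 → F := ![0, 1, 1]
  let w : Fin 3 → F := ![1, 1, -1]
  obtain ⟨c, hsum, hle, hne⟩ := exists_word_of_points hq (by omega : 0 < m) hF hK hβ ha
    (fun s : Fin 3 × (Fin l → F) => A s.1 • u + B s.1 • v + y s.2) fun s => w s.1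
  have hc : c ∈ codeC q m l a β := by
    refine (mem_constacyclicCode_genPoly (by omega) hF hβ ha (setT_closed (by omega) m l)
      (fun i hi => modEq_one_of_mem_setT hq hi) c).2 fun i hi => ?_
    have hi2 := (mem_setT.1 hi).2
    rw [hsum i (modEq_one_of_mem_setT hq hi), Fintype.sum_prod_type, Fin.sum_univ_three]
    have := sum_add_pow_additive (by omega) y
      (by rw [hF', Fintype.card_fin]; exact hi2 : wtq (Fintype.card F) i = _) u v
    simp [A, B, w, this]
  have hc0 : c ≠ 0 := by
    -- The point `u` is isolated projectively: a multiple of `u` has no `v`-component, and only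
    -- index `0` has `B = 0`.
    refine hne (0, 0) (by simp [w]) (fun h => ?_) ?_
    · exact one_ne_zero (hind 0 _ _ h).1
    · rintro ⟨k, t⟩ r h
      obtain ⟨h1, h2, h3⟩ := hind t (A k - r) (B k) (by
        simp only [A, B, Matrix.cons_val_zero, one_smul, zero_smul, add_zero, map_zero] at h ⊢
        rw [sub_smul, ← sub_eq_zero.2 h]
        abel)
      have hk : k = 0 := by
        fin_cases k <;> simp [B] at h2 ⊢
      rw [hk, h3]
  refine (minDist_le_hammingNorm hc hc0).trans (Nat.cast_le.2 (hle.trans_eq ?_))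
  simp [hF']

end Constacyclic

end

theorem mainTheorem10 {F K : Type*} [Field F] [DecidableEq F] [Field K] [Algebra F K]
    (q m : ℕ) (hq : 2 < q) (hF : Nat.card F = q) (hK : Module.finrank F K = m)
    (β : K) (hβ : IsPrimitiveRoot β (q ^ m - 1))
    (a : F) (ha : algebraMap F K a = β ^ ((q ^ m - 1) / (q - 1)))
    (l : ℕ) (hl1 : 1 ≤ l) (hl2 : l + 2 ≤ m) :
    Constacyclic.CPRM q m (m - 2 - l) a β =
        Constacyclic.CPRM q m (m - 1 - l) a β ⊓ Constacyclic.codeC q m l a β ∧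
      Constacyclic.minDist (Constacyclic.codeC q m l a β) ≤ ((3 * q ^ l : ℕ) : ℕ∞) := by
  refine ⟨?_, Constacyclic.minDist_codeC_le hq hF hK hβ ha hl2⟩
  -- With `ℓ ≥ 1`, the natural subtraction `m - 2 - (m - 1 - ℓ)` really is `ℓ - 1`.
  obtain ⟨k, rfl⟩ : ∃ k, l = k + 1 := ⟨l - 1, by omega⟩
  have h1 : m - 2 - (m - 2 - (k + 1)) = k + 1 := by omega
  have h2 : m - 2 - (m - 1 - (k + 1)) = k := by omega
  have hD : ∀ j (c : Fin ((q ^ m - 1) / (q - 1)) → F), _ ↔ _ := fun j c =>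
    Constacyclic.mem_constacyclicCode_genPoly (by omega) hF hβ ha
      (Constacyclic.setD_closed q m j) (fun i hi => ((Constacyclic.mem_setD hq).1 hi).2.1) c
  ext c
  rw [Submodule.mem_inf, Constacyclic.CPRM, Constacyclic.CPRM, Constacyclic.codeC, h1, h2, hD, hD,
    Constacyclic.mem_constacyclicCode_genPoly (by omega) hF hβ ha
      (Constacyclic.setT_closed (by omega) m (k + 1))
      (fun i hi => Constacyclic.modEq_one_of_mem_setT hq hi), Constacyclic.setD_succ hq]
  exact Finset.forall_mem_union
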